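/- Let $H$ be a complex Hilbert space with a conjugation $J$ (a conjugate-linear isometric involution). On the antisymmetric Fock space $\Lambda(H)=\bigoplus_{n\ge0}\Lambda^n(H)$, with scalar product $\langle u_1\wedge\dots\wedge u_n,v_1\wedge\dots\wedge v_n\rangle=\det(\langle u_k,v_j\rangle)$ and vacuum vector $\mathbb 1$, let $c(v)$ be the creator $u_1\wedge\dots\wedge u_n\mapsto v\wedge u_1\wedge\dots\wedge u_n$, and let $\Phi(v)=c(v)+c(Jv)^*$. For a closed $J$-invariant subspace $K\subseteq H$ let $\mathcal C(K)\subseteq B(\Lambda(H))$ be the von Neumann algebra generated by $\{\Phi(v):v\in K\}$. Put $\mathcal C=\mathcal C(H)$, with the trace $\tau(x)=\langle x\mathbb 1,\mathbb 1\rangle$, and let $\|x\|_p=\tau(|x|^p)^{1/p}$ for $1\le p<\infty$ and $\|x\|_\infty=\|x\|$. For a sequence $a=(a_n)_{n\ge0}$ in $\mathcal C$ define, in $[0,\infty]$, $$\|a\|_{L^p(\mathcal C;\ell^2_C)}=\sup_n\Big\|\Big(\sum_{k=0}^n|a_k|^2\Big)^{1/2}\Big\|_p,\qquad \|a\|_{L^p(\mathcal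 C;\ell^2_R)}=\sup_n\Big\|\Big(\sum_{k=0}^n|a_k^*|^2\Big)^{1/2}\Big\|_p .$$ Let $H_0\subseteq H_1\subseteq\cdots$ be $J$-invariant subspaces of $H$ with $\dim H_n=n$ and $\overline{\bigcup_nH_n}=H$, and let $(e_n)_{n\ge1}$ be unit vectors with $Je_n=e_n$ and $e_n\in H_n\ominus H_{n-1}$. Put $\mathcal C_n=\mathcal C(H_n)$ for $n\ge0$ (a finite-dimensional algebra, so that $L^p(\mathcal C_n)=\mathcal C_n$ as a vector space), and by convention $\mathcal C_{-1}=\mathcal C_0=\mathbb C1$ and $\Phi(e_0)=1$. Proposition 3.3. Let $1\le p\le\infty$, and let $x=(x_n)_{n\ge0}$ be a Clifford martingale, that is, $x_n\in\mathcal C_n$ for all $n$, and $x_m$ is the $\tau$-preserving conditional expectation of $x_n$ on $\mathcal C_m$ for all $m\le n$. Let $dx_0=x_0$ and $dx_n=x_n-x_{n-1}$ for $n\ge1$, and suppose that $dx_n=\varphi_n\Phi(e_n)$ with $\varphi_n\in\mathcal C_{n-1}$ for all $n\ge0$. Then, in $[0,\infty]$, $$\|dx\|_{L^p(\mathcal C;\ell^2_R)}=\|\varphi\|_{L^p(\mathcal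 C;\ell^2_R)}\qquad\text{and}\qquad\tfrac12\|\varphi\|_{L^p(\mathcal C;\ell^2_C)}\le\|dx\|_{L^p(\mathcal C;\ell^2_C)}\le2\|\varphi\|_{L^p(\mathcal C;\ell^2_C)} .$$ -/

import Mathlib

open scoped ENNReal

namespace Clifford

/-! ### The antisymmetric Fock space -/

section Kernel

variable {H : Type*} [NormedAddCommGroup H] [InnerProductSpace ℂ H]

/-- The Gram determinant `det ⟨u_i, w_j⟩` of two `n`-tuples of vectors. -/
noncomputable def gramDet (n : ℕ) (u w : Fin n → H) : ℂ :=
  Matrix.det (Matrix.of fun i j => inner ℂ (u i) (w j))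

/-- The scalar product of the formal wedge products `u_1 ∧ ⋯ ∧ u_n` and `w_1 ∧ ⋯ ∧ w_m`: the
Gram determinant if `n = m`, and `0` if the degrees differ. -/
noncomputable def wedgeKernel (x y : Σ n : ℕ, Fin n → H) : ℂ :=
  if h : x.1 = y.1 then gramDet x.1 x.2 (fun i => y.2 (Fin.cast h i)) else 0

theorem wedgeKernel_same (n : ℕ) (u w : Fin n → H) :
    wedgeKernel ⟨n, u⟩ ⟨n, w⟩ = gramDet n u w := by
  simp [wedgeKernel]

theorem wedgeKernel_ne {n m : ℕ} (h : n ≠ m) (u : Fin n → H) (w : Fin m → H) :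
    wedgeKernel ⟨n, u⟩ ⟨m, w⟩ = 0 := by
  simp [wedgeKernel, h]

theorem gramDet_conj (n : ℕ) (u w : Fin n → H) :
    (starRingEnd ℂ) (gramDet n w u) = gramDet n u w := by
  rw [gramDet, gramDet, ← Matrix.det_transpose, RingHom.map_det]
  congr 1
  ext i j
  simp

theorem wedgeKernel_conj (x y : Σ n : ℕ, Fin n → H) :
    (starRingEnd ℂ) (wedgeKernel y x) = wedgeKernel x y := by
  obtain ⟨n, u⟩ := x
  obtain ⟨m, w⟩ := y
  by_cases h : n = m
  · subst h
    rw [wedgeKernel_same, wedgeKernel_same, gramDet_conj]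
  · rw [wedgeKernel_ne h, wedgeKernel_ne (Ne.symm h), map_zero]

/-- Expansion of the Gram determinant along its first row. -/
theorem gramDet_cons (n : ℕ) (v : H) (u : Fin n → H) (w : Fin (n + 1) → H) :
    gramDet (n + 1) (Fin.cons v u : Fin (n + 1) → H) w =
      ∑ j : Fin (n + 1), (-1) ^ (j : ℕ) * inner ℂ v (w j) * gramDet n u (w ∘ j.succAbove) := by
  rw [gramDet, Matrix.det_succ_row_zero]
  refine Finset.sum_congr rfl fun j _ => ?_
  rw [gramDet]
  congr 2

open scoped ComplexOrder in
theorem posSemidef_inner {X E : Type*} [NormedAddCommGroup E] [InnerProductSpace ℂ E]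
    (F : X → E) : Matrix.PosSemidef (Matrix.of fun x y : X => inner ℂ (F x) (F y)) := by
  refine ⟨?_, fun f => ?_⟩
  · ext x y
    simp [Matrix.conjTranspose_apply]
  · have h : (f.sum fun x a => f.sum fun y b =>
        star a * (Matrix.of fun x y : X => inner ℂ (F x) (F y)) x y * b) =
        inner ℂ (f.sum fun x a => a • F x) (f.sum fun x a => a • F x) := by
      simp only [Finsupp.sum, sum_inner, inner_sum, inner_smul_left, inner_smul_right,
        Matrix.of_apply, RCLike.star_def]
      rw [Finset.sum_comm]
      refine Finset.sum_congr rfl fun y _ => ?_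
      rw [Finset.mul_sum]
      refine Finset.sum_congr rfl fun x _ => ?_
      ring
    rw [h, inner_self_eq_norm_sq_to_K]
    refine Complex.le_def.2 ⟨?_, ?_⟩ <;> simp [← Complex.ofReal_pow]

open scoped ComplexOrder in
/-- The product kernel `∏ ⟨u_i, w_i⟩` is positive semidefinite. -/
theorem posSemidef_prod (n : ℕ) (s : Finset (Fin n)) :
    Matrix.PosSemidef (Matrix.of fun u w : Fin n → H => ∏ i ∈ s, inner ℂ (u i) (w i)) := by
  classical
  induction s using Finset.induction_on with
  | empty =>
    have h := posSemidef_inner (fun _ : Fin n → H => (1 : ℂ))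
    have e : (Matrix.of fun u w : Fin n → H => ∏ i ∈ (∅ : Finset (Fin n)), inner ℂ (u i) (w i)) =
        Matrix.of fun _ _ : Fin n → H => inner ℂ (1 : ℂ) (1 : ℂ) := by
      ext u w
      simp
    rw [e]
    exact h
  | insert a s ha ih =>
    have h := (posSemidef_inner (fun u : Fin n → H => u a)).hadamard ih
    have e : (Matrix.of fun u w : Fin n → H => ∏ i ∈ insert a s, inner ℂ (u i) (w i)) =
        Matrix.hadamard (Matrix.of fun u w : Fin n → H => inner ℂ (u a) (w a))
          (Matrix.of fun u w : Fin n → H => ∏ i ∈ s, inner ℂ (u i) (w i)) := by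
      ext u w
      simp [Finset.prod_insert ha]
    rw [e]
    exact h

theorem sum_sign_prod (n : ℕ) (u w : Fin n → H) :
    ∑ σ : Equiv.Perm (Fin n), ∑ τ : Equiv.Perm (Fin n),
      ((Equiv.Perm.sign σ : ℤ) : ℂ) * ((Equiv.Perm.sign τ : ℤ) : ℂ) *
        ∏ i, inner ℂ (u (σ i)) (w (τ i)) = (n.factorial : ℂ) * gramDet n u w := by
  have key : ∀ τ : Equiv.Perm (Fin n),
      ∑ σ : Equiv.Perm (Fin n), ((Equiv.Perm.sign σ : ℤ) : ℂ) * ((Equiv.Perm.sign τ : ℤ) : ℂ) *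
        ∏ i, inner ℂ (u (σ i)) (w (τ i)) = gramDet n u w := by
    intro τ
    have h := Matrix.det_permute' τ (Matrix.of fun i j => inner ℂ (u i) (w j))
    have h2 : ((Equiv.Perm.sign τ : ℤ) : ℂ) * ((Equiv.Perm.sign τ : ℤ) : ℂ) = 1 := by
      rcases Int.units_eq_one_or (Equiv.Perm.sign τ) with h | h <;> simp [h]
    calc _ = ((Equiv.Perm.sign τ : ℤ) : ℂ) *
          ((Matrix.of fun i j => inner ℂ (u i) (w j)).submatrix id τ).det := by
          rw [Matrix.det_apply', Finset.mul_sum]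
          refine Finset.sum_congr rfl fun σ _ => ?_
          simp only [Matrix.submatrix_apply, Matrix.of_apply, id]
          ring
      _ = _ := by rw [h, ← mul_assoc, h2, one_mul, gramDet]
  rw [Finset.sum_comm, Finset.sum_congr rfl (fun τ _ => key τ)]
  simp [Fintype.card_perm]

open scoped ComplexOrder in
/-- The Gram determinant kernel is positive semidefinite. -/
theorem gramDet_nonneg (n : ℕ) (f : (Fin n → H) →₀ ℂ) :
    0 ≤ f.sum fun u a => f.sum fun w b => star a * gramDet n u w * b := by
  classical
  let g : (Fin n → H) →₀ ℂ := f.sum fun u a => ∑ σ : Equiv.Perm (Fin n),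
    Finsupp.single (u ∘ σ) (((Equiv.Perm.sign σ : ℤ) : ℂ) * a)
  have hg := (posSemidef_prod (H := H) n Finset.univ).2 g
  have hexp : (g.sum fun u a => g.sum fun w b =>
      star a * (Matrix.of fun u w : Fin n → H => ∏ i, inner ℂ (u i) (w i)) u w * b) =
      (n.factorial : ℂ) * f.sum fun u a => f.sum fun w b => star a * gramDet n u w * b := by
    have inner1 : ∀ F : (Fin n → H) → ℂ, (g.sum fun w b => F w * b) =
        f.sum fun w b => (∑ τ : Equiv.Perm (Fin n),
          ((Equiv.Perm.sign τ : ℤ) : ℂ) * F (w ∘ τ)) * b := by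
      intro F
      have hl : ∀ k : (Fin n → H) →₀ ℂ, (k.sum fun w b => F w * b) =
          (Finsupp.linearCombination ℂ F) k := by
        intro k
        rw [Finsupp.linearCombination_apply]
        refine Finsupp.sum_congr fun w _ => ?_
        simp [mul_comm]
      rw [hl]
      simp only [g, Finsupp.sum, map_sum, Finsupp.linearCombination_single, smul_eq_mul]
      refine Finset.sum_congr rfl fun w _ => ?_
      rw [Finset.sum_mul]
      refine Finset.sum_congr rfl fun τ _ => ?_
      ring
    have inner2 : ∀ F : (Fin n → H) → ℂ, (g.sum fun w b => star b * F w) =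
        f.sum fun w b => star b * (∑ τ : Equiv.Perm (Fin n),
          ((Equiv.Perm.sign τ : ℤ) : ℂ) * F (w ∘ τ)) := by
      intro F
      have h := congrArg star (inner1 (fun w => star (F w)))
      simp only [Finsupp.sum, star_sum, star_mul', star_star] at h
      simp only [Finsupp.sum]
      refine Eq.trans (Finset.sum_congr rfl fun w _ => mul_comm _ _) (h.trans ?_)
      refine Finset.sum_congr rfl fun w _ => ?_
      rw [mul_comm]
      congr 1
      refine Finset.sum_congr rfl fun τ _ => ?_
      simp
    have e1 : (g.sum fun u a => g.sum fun w b =>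
        star a * (Matrix.of fun u w : Fin n → H => ∏ i, inner ℂ (u i) (w i)) u w * b) =
        g.sum fun u a => star a * (f.sum fun w b => (∑ τ : Equiv.Perm (Fin n),
          ((Equiv.Perm.sign τ : ℤ) : ℂ) * ∏ i, inner ℂ (u i) (w (τ i))) * b) := by
      refine Finsupp.sum_congr fun u _ => ?_
      have := inner1 (fun w => ∏ i, inner ℂ (u i) (w i))
      simp only [Function.comp_apply] at this
      rw [← this, Finsupp.mul_sum]
      refine Finsupp.sum_congr fun w _ => ?_
      simp [mul_assoc]
    rw [e1, inner2 (fun u => f.sum fun w b => (∑ τ : Equiv.Perm (Fin n),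
          ((Equiv.Perm.sign τ : ℤ) : ℂ) * ∏ i, inner ℂ (u i) (w (τ i))) * b), Finsupp.mul_sum]
    refine Finsupp.sum_congr fun u _ => ?_
    simp only [Finsupp.sum, Finset.mul_sum, Function.comp_apply]
    rw [Finset.sum_comm]
    refine Finset.sum_congr rfl fun w _ => ?_
    have h := sum_sign_prod n u w
    calc _ = star (f u) * (∑ σ : Equiv.Perm (Fin n), ∑ τ : Equiv.Perm (Fin n),
      ((Equiv.Perm.sign σ : ℤ) : ℂ) * ((Equiv.Perm.sign τ : ℤ) : ℂ) *
        ∏ i, inner ℂ (u (σ i)) (w (τ i))) * f w := by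
          simp only [Finset.mul_sum, Finset.sum_mul]
          refine Finset.sum_congr rfl fun σ _ => Finset.sum_congr rfl fun τ _ => ?_
          ring
      _ = _ := by rw [h]; ring
  rw [hexp] at hg
  have hn : (0 : ℂ) < (n.factorial : ℂ) := by exact_mod_cast n.factorial_pos
  have h2 := mul_nonneg (inv_nonneg.2 hn.le) hg
  rwa [inv_mul_cancel_left₀ hn.ne'] at h2

end Kernel

/-- Formal finite linear combinations of wedge products `u_1 ∧ ⋯ ∧ u_n`, `n ≥ 0`, of vectors
of `H`. -/
def PreFock (H : Type*) : Type _ := (Σ n : ℕ, Fin n → H) →₀ ℂ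

noncomputable instance (H : Type*) : AddCommGroup (PreFock H) :=
  inferInstanceAs (AddCommGroup ((Σ n : ℕ, Fin n → H) →₀ ℂ))

noncomputable instance (H : Type*) : Module ℂ (PreFock H) :=
  inferInstanceAs (Module ℂ ((Σ n : ℕ, Fin n → H) →₀ ℂ))

/-- The formal wedge product `u_1 ∧ ⋯ ∧ u_n`. -/
noncomputable def preWedge {H : Type*} (n : ℕ) (u : Fin n → H) : PreFock H :=
  Finsupp.single (⟨n, u⟩ : Σ n : ℕ, Fin n → H) (1 : ℂ)

/-- Linear maps out of `PreFock H` are determined by the wedge products. -/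
theorem preFock_induction {H : Type*} {P : PreFock H → Prop} (f : PreFock H) (h0 : P 0)
    (hadd : ∀ f g, P f → P g → P (f + g))
    (hw : ∀ (c : ℂ) (n : ℕ) (u : Fin n → H), P (c • preWedge n u)) : P f := by
  refine Finsupp.induction_linear (motive := P) f h0 hadd ?_
  rintro ⟨n, u⟩ c
  have : (Finsupp.single (⟨n, u⟩ : Σ n : ℕ, Fin n → H) c) = c • preWedge n u :=
    (Finsupp.smul_single_one _ _).symm
  rw [this]
  exact hw c n u

/-- The linear extension of a map on wedge products. -/
noncomputable def preLift {H V : Type*} [AddCommGroup V] [Module ℂ V]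
    (F : (Σ n : ℕ, Fin n → H) → V) : PreFock H →ₗ[ℂ] V :=
  Finsupp.linearCombination ℂ F

theorem preLift_preWedge {H V : Type*} [AddCommGroup V] [Module ℂ V]
    (F : (Σ n : ℕ, Fin n → H) → V) (n : ℕ) (u : Fin n → H) :
    preLift F (preWedge n u) = F ⟨n, u⟩ :=
  (Finsupp.linearCombination_single ℂ _ _).trans (one_smul _ _)

section Fock

variable {H : Type*} [NormedAddCommGroup H] [InnerProductSpace ℂ H]

open scoped ComplexOrder in
theorem wedgeKernel_nonneg (f : (Σ n : ℕ, Fin n → H) →₀ ℂ) :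
    0 ≤ f.sum fun x a => f.sum fun y b => star a * wedgeKernel x y * b := by
  classical
  have h : (f.sum fun x a => f.sum fun y b => star a * wedgeKernel x y * b) =
      ∑ n ∈ f.splitSupport, (f.split n).sum fun u a => (f.split n).sum fun w b =>
        star a * gramDet n u w * b := by
    rw [Finsupp.sigma_sum]
    refine Finset.sum_congr rfl fun n hn => ?_
    refine Finsupp.sum_congr fun u _ => ?_
    rw [Finsupp.sigma_sum, Finset.sum_eq_single n]
    · simp only [wedgeKernel_same]
    · intro m _ hm
      simp [wedgeKernel_ne (Ne.symm hm), Finsupp.sum]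
    · exact fun h => absurd hn h
  rw [h]
  exact Finset.sum_nonneg fun n _ => gramDet_nonneg n _

/-- The sesquilinear extension of
`⟨u_1 ∧ ⋯ ∧ u_n, w_1 ∧ ⋯ ∧ w_m⟩ = δ_{nm} det ⟨u_i, w_j⟩` (conjugate linear in the first
variable). -/
noncomputable def preInner (f g : (Σ n : ℕ, Fin n → H) →₀ ℂ) : ℂ :=
  f.sum fun x a => g.sum fun y b => star a * wedgeKernel x y * b

theorem preInner_conj (f g : (Σ n : ℕ, Fin n → H) →₀ ℂ) :
    (starRingEnd ℂ) (preInner g f) = preInner f g := by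
  rw [preInner, preInner, Finsupp.sum_comm]
  simp only [map_finsuppSum]
  refine Finsupp.sum_congr fun x _ => Finsupp.sum_congr fun y _ => ?_
  rw [map_mul, map_mul, wedgeKernel_conj]
  simp only [RCLike.star_def, RCLike.conj_conj]
  ring

theorem preInner_add (f g k : (Σ n : ℕ, Fin n → H) →₀ ℂ) :
    preInner (f + g) k = preInner f k + preInner g k := by
  refine Finsupp.sum_add_index' (fun x => by simp) (fun x a b => ?_)
  rw [← Finsupp.sum_add]
  refine Finsupp.sum_congr fun y _ => ?_
  simp only [star_add]
  ring

theorem preInner_smul (f g : (Σ n : ℕ, Fin n → H) →₀ ℂ) (r : ℂ) :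
    preInner (r • f) g = (starRingEnd ℂ) r * preInner f g := by
  refine (Finsupp.sum_smul_index (fun x => by simp)).trans ?_
  simp only [preInner, Finsupp.mul_sum, star_mul', RCLike.star_def, mul_assoc]

noncomputable instance preFockCore : PreInnerProductSpace.Core ℂ (PreFock H) where
  inner f g := preInner f g
  conj_inner_symm f g := preInner_conj f g
  re_inner_nonneg f := (Complex.le_def.1 (wedgeKernel_nonneg f)).1
  add_left f g k := preInner_add f g k
  smul_left f g r := preInner_smul f g r

noncomputable instance : SeminormedAddCommGroup (PreFock H) :=
  InnerProductSpace.Core.toSeminormedAddCommGroup (𝕜 := ℂ)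

noncomputable instance : InnerProductSpace ℂ (PreFock H) := .ofCore _

theorem inner_preWedge (n : ℕ) (u : Fin n → H) (m : ℕ) (w : Fin m → H) :
    inner ℂ (preWedge n u) (preWedge m w) = wedgeKernel ⟨n, u⟩ ⟨m, w⟩ := by
  change preInner (Finsupp.single _ _) (Finsupp.single _ _) = _
  simp [preInner]

/-- The creator on formal combinations: `u_1 ∧ ⋯ ∧ u_n ↦ v ∧ u_1 ∧ ⋯ ∧ u_n`. -/
noncomputable def preCreator (v : H) : PreFock H →ₗ[ℂ] PreFock H :=
  preLift fun x => preWedge (x.1 + 1) (Fin.cons v x.2)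

/-- The annihilator on formal combinations:
`u_0 ∧ ⋯ ∧ u_n ↦ ∑_j (-1)^j ⟨v, u_j⟩ u_0 ∧ ⋯ ∧ û_j ∧ ⋯ ∧ u_n`. -/
noncomputable def preAnnihilator (v : H) : PreFock H →ₗ[ℂ] PreFock H :=
  preLift fun x => match x with
    | ⟨0, _⟩ => 0
    | ⟨n + 1, u⟩ => ∑ j : Fin (n + 1), ((-1) ^ (j : ℕ) * inner ℂ v (u j)) •
        preWedge n (u ∘ j.succAbove)

theorem preCreator_preWedge (v : H) (n : ℕ) (u : Fin n → H) :
    preCreator v (preWedge n u) = preWedge (n + 1) (Fin.cons v u) :=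
  preLift_preWedge _ _ _

theorem preAnnihilator_preWedge_zero (v : H) (u : Fin 0 → H) :
    preAnnihilator v (preWedge 0 u) = 0 :=
  preLift_preWedge _ _ _

theorem preAnnihilator_preWedge_succ (v : H) (n : ℕ) (u : Fin (n + 1) → H) :
    preAnnihilator v (preWedge (n + 1) u) =
      ∑ j : Fin (n + 1), ((-1) ^ (j : ℕ) * inner ℂ v (u j)) • preWedge n (u ∘ j.succAbove) :=
  preLift_preWedge _ _ _

theorem inner_preCreator (v : H) (f g : PreFock H) :
    inner ℂ (preCreator v f) g = inner ℂ f (preAnnihilator v g) := by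
  induction f using preFock_induction with
  | h0 => simp
  | hadd f f' hf hf' => rw [map_add, inner_add_left, inner_add_left, hf, hf']
  | hw c n u =>
    rw [map_smul, inner_smul_left, inner_smul_left]
    congr 1
    induction g using preFock_induction with
    | h0 => simp
    | hadd g g' hg hg' => rw [map_add, inner_add_right, inner_add_right, hg, hg']
    | hw d m w =>
      rw [map_smul, inner_smul_right, inner_smul_right]
      congr 1
      rw [preCreator_preWedge, inner_preWedge]
      cases m with
      | zero =>
        rw [preAnnihilator_preWedge_zero, inner_zero_right, wedgeKernel_ne (by omega)]
      | succ m =>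
        rw [preAnnihilator_preWedge_succ, inner_sum]
        simp only [inner_smul_right, inner_preWedge]
        by_cases h : n = m
        · subst h
          simp only [wedgeKernel_same, gramDet_cons]
        · rw [wedgeKernel_ne (by omega)]
          simp [wedgeKernel_ne h]

/-- The anticommutation relation between the creator and the annihilator of one vector. -/
theorem preAnnihilator_preCreator (v : H) (f : PreFock H) :
    preAnnihilator v (preCreator v f) =
      inner ℂ v v • f - preCreator v (preAnnihilator v f) := by
  induction f using preFock_induction with
  | h0 => simp
  | hadd f g hf hg => simp only [map_add, hf, hg, smul_add]; abel
  | hw c n u =>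
    simp only [map_smul]
    rw [smul_comm, ← smul_sub]
    congr 1
    rw [preCreator_preWedge, preAnnihilator_preWedge_succ, Fin.sum_univ_succ]
    have h0 : (Fin.cons v u : Fin (n + 1) → H) ∘ (0 : Fin (n + 1)).succAbove = u := by
      ext i; simp
    rw [h0, sub_eq_add_neg]
    congr 1
    · simp
    · cases n with
      | zero => rw [preAnnihilator_preWedge_zero]; simp
      | succ n =>
        rw [preAnnihilator_preWedge_succ, map_sum, ← Finset.sum_neg_distrib]
        refine Finset.sum_congr rfl fun j _ => ?_
        have hj : (Fin.cons v u : Fin (n + 2) → H) ∘ j.succ.succAbove =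
            Fin.cons v (u ∘ j.succAbove) := by
          ext i
          refine Fin.cases ?_ (fun i => ?_) i <;> simp
        rw [hj, map_smul, preCreator_preWedge, ← neg_smul]
        congr 1
        simp [pow_succ]

theorem norm_preCreator_le (v : H) (f : PreFock H) : ‖preCreator v f‖ ≤ ‖v‖ * ‖f‖ := by
  have h : ‖preCreator v f‖ ^ 2 + ‖preAnnihilator v f‖ ^ 2 = (‖v‖ * ‖f‖) ^ 2 := by
    have h1 : (inner ℂ (preCreator v f) (preCreator v f) : ℂ) =
        inner ℂ v v * inner ℂ f f - inner ℂ (preAnnihilator v f) (preAnnihilator v f) := by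
      rw [inner_preCreator, preAnnihilator_preCreator, inner_sub_right, inner_smul_right,
        ← inner_conj_symm f (preCreator v _), inner_preCreator, inner_conj_symm]
    simp only [inner_self_eq_norm_sq_to_K] at h1
    have h2 : ‖preCreator v f‖ ^ 2 = ‖v‖ ^ 2 * ‖f‖ ^ 2 - ‖preAnnihilator v f‖ ^ 2 := by
      exact_mod_cast h1
    rw [h2]
    ring
  refine le_of_sq_le_sq ?_ (by positivity)
  nlinarith [sq_nonneg ‖preAnnihilator v f‖]

end Fock

/-- The antisymmetric Fock space `Λ(H) = ⨁_n Λⁿ(H)`: the Hilbert space spanned by the vectors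
`u_1 ∧ ⋯ ∧ u_n` with scalar products `δ_{nm} det ⟨u_i, w_j⟩`. (The completion also identifies
formal combinations at distance `0`, such as those expressing multilinearity and antisymmetry
of the wedge product.) -/
def Fock (H : Type*) [NormedAddCommGroup H] [InnerProductSpace ℂ H] : Type _ :=
  UniformSpace.Completion (PreFock H)

section Fields

variable {H : Type*} [NormedAddCommGroup H] [InnerProductSpace ℂ H]

noncomputable instance : NormedAddCommGroup (Fock H) :=
  inferInstanceAs (NormedAddCommGroup (UniformSpace.Completion (PreFock H)))

noncomputable instance : InnerProductSpace ℂ (Fock H) :=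
  inferInstanceAs (InnerProductSpace ℂ (UniformSpace.Completion (PreFock H)))

instance : CompleteSpace (Fock H) :=
  inferInstanceAs (CompleteSpace (UniformSpace.Completion (PreFock H)))

/-- The vector `u_1 ∧ ⋯ ∧ u_n` of the Fock space. -/
noncomputable def wedge (n : ℕ) (u : Fin n → H) : Fock H :=
  UniformSpace.Completion.coe' (preWedge n u)

/-- The vacuum vector, the empty wedge product. -/
noncomputable def vacuum (H : Type*) [NormedAddCommGroup H] [InnerProductSpace ℂ H] : Fock H :=
  wedge 0 Fin.elim0

/-- The creator `c(v)`, a bounded operator on the Fock space. -/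
noncomputable def creator (v : H) : Fock H →L[ℂ] Fock H :=
  ((preCreator v).mkContinuous ‖v‖ (norm_preCreator_le v)).completion

theorem inner_wedge_wedge (n : ℕ) (u w : Fin n → H) :
    inner ℂ (wedge n u) (wedge n w) = Matrix.det (Matrix.of fun i j => inner ℂ (u i) (w j)) :=
  (UniformSpace.Completion.inner_coe _ _).trans
    ((inner_preWedge n u n w).trans (wedgeKernel_same n u w))

theorem inner_wedge_wedge_of_ne {n m : ℕ} (h : n ≠ m) (u : Fin n → H) (w : Fin m → H) :
    inner ℂ (wedge n u) (wedge m w) = 0 :=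
  (UniformSpace.Completion.inner_coe _ _).trans
    ((inner_preWedge n u m w).trans (wedgeKernel_ne h u w))

theorem creator_wedge (v : H) (n : ℕ) (u : Fin n → H) :
    creator v (wedge n u) = wedge (n + 1) (Fin.cons v u) :=
  (ContinuousLinearMap.completion_apply_coe _ _).trans
    (congrArg UniformSpace.Completion.coe' (preCreator_preWedge v n u))

/-- The annihilator `a(v) = c(v)*`. -/
noncomputable def annihilator (v : H) : Fock H →L[ℂ] Fock H :=
  ContinuousLinearMap.adjoint (creator v)

/-- The Fermion field `Φ(v) = c(v) + a(Jv)`, for a conjugation `J`. -/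
noncomputable def field (J : H ≃ₗᵢ⋆[ℂ] H) (v : H) : Fock H →L[ℂ] Fock H :=
  creator v + annihilator (J v)

end Fields

/-! ### Von Neumann algebras with a trace -/

section VonNeumann

variable {F : Type*} [NormedAddCommGroup F] [InnerProductSpace ℂ F] [CompleteSpace F]

/-- The von Neumann algebra generated by a set `S` of bounded operators on a Hilbert space: the
double commutant of `S ∪ S*`. -/
noncomputable def vonNeumannGenerated (S : Set (F →L[ℂ] F)) : VonNeumannAlgebra F where
  toStarSubalgebra :=
    StarSubalgebra.centralizer ℂ (StarSubalgebra.centralizer ℂ S : Set (F →L[ℂ] F))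
  centralizer_centralizer' := by
    simp

/-- The norm of `L^p(M, τ)` on the elements `x` of a von Neumann algebra `M` with a finite
trace `τ`: `τ(|x|^p)^{1/p}` for `p < ∞`, and the operator norm for `p = ∞`. -/
noncomputable def lpNorm (τ : (F →L[ℂ] F) → ℂ) (p : ℝ≥0∞) (x : F →L[ℂ] F) : ℝ≥0∞ :=
  if p = ∞ then ENNReal.ofReal ‖x‖
  else ENNReal.ofReal ((τ (CFC.abs x ^ p.toReal)).re ^ (1 / p.toReal))

/-- The norm of `L^p(M; ℓ²_C)` (column norm) of a sequence of elements of `M`: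
`sup_n ‖(∑_{k ≤ n} |a_k|²)^{1/2}‖_p`, with the value `∞` for sequences outside
`L^p(M; ℓ²_C)`. -/
noncomputable def columnNorm (τ : (F →L[ℂ] F) → ℂ) (p : ℝ≥0∞) (a : ℕ → F →L[ℂ] F) : ℝ≥0∞ :=
  ⨆ n : ℕ, lpNorm τ p (CFC.sqrt (∑ k ∈ Finset.range (n + 1), CFC.abs (a k) ^ 2))

/-- The norm of `L^p(M; ℓ²_R)` (row norm) of a sequence of elements of `M`:
`sup_n ‖(∑_{k ≤ n} |a_k*|²)^{1/2}‖_p`, with the value `∞` for sequences outside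
`L^p(M; ℓ²_R)`. -/
noncomputable def rowNorm (τ : (F →L[ℂ] F) → ℂ) (p : ℝ≥0∞) (a : ℕ → F →L[ℂ] F) : ℝ≥0∞ :=
  ⨆ n : ℕ, lpNorm τ p (CFC.sqrt (∑ k ∈ Finset.range (n + 1), CFC.abs (star (a k)) ^ 2))

/-- `z` is the conditional expectation `E(x | M)` with respect to `τ`. -/
def IsCondExp (τ : (F →L[ℂ] F) → ℂ) (M : VonNeumannAlgebra F) (x z : F →L[ℂ] F) : Prop :=
  z ∈ M ∧ ∀ y ∈ M, τ (z * y) = τ (x * y)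

/-- Martingales of elements of von Neumann algebras with respect to a filtration `M 0 ⊆ M 1 ⊆ ⋯`:
`x n ∈ M n` and `E(x n | M m) = x m` for `m ≤ n`. -/
def IsMartingale (τ : (F →L[ℂ] F) → ℂ) (M : ℕ → VonNeumannAlgebra F) (x : ℕ → F →L[ℂ] F) :
    Prop :=
  (∀ n, x n ∈ M n) ∧ ∀ n, ∀ m ≤ n, IsCondExp τ (M m) (x n) (x m)

/-- The difference sequence `dx_n = x_n - x_{n-1}`, with `x_{-1} = 0`. -/
def martingaleDiff (x : ℕ → F →L[ℂ] F) : ℕ → F →L[ℂ] F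
  | 0 => x 0
  | n + 1 => x (n + 1) - x n

end VonNeumann

/-! ### The von Neumann Clifford algebra -/

section Algebra

variable {H : Type*} [NormedAddCommGroup H] [InnerProductSpace ℂ H]

/-- `C(K)` for a `J`-invariant closed subspace `K` of `H`, as a von Neumann subalgebra of `C(H)`:
generated by the `Φ(v)` with `v ∈ K`. The Clifford algebra `C(H)` itself is the case `K = ⊤`.
If `dim K = n < ∞`, then `C(K)` has dimension `2^n`, so that for every `p` the space `L^p(C(K))`
consists of the elements of `C(K)`. -/
noncomputable def cliffordAlg (J : H ≃ₗᵢ⋆[ℂ] H) (K : Submodule ℂ H) :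
    VonNeumannAlgebra (Fock H) :=
  vonNeumannGenerated (field J '' (K : Set H))

/-- The vacuum state `τ(x) = ⟨x 𝟙, 𝟙⟩` (the scalar product of Mathlib is conjugate linear in the
first variable). It is the normalized trace on `C(H)`. -/
noncomputable def vacuumTrace (x : Fock H →L[ℂ] Fock H) : ℂ :=
  inner ℂ (vacuum H) (x (vacuum H))

end Algebra

end Clifford

namespace Clifford

/-! ### Trace-preserving automorphisms and the row and column norms. -/

section StarAut

variable {F : Type*} [NormedAddCommGroup F] [InnerProductSpace ℂ F] [CompleteSpace F]

/-! Write `f` for `field J (e n)`, which is self-adjoint with square `1`, and let `d = φ n * f`.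
Then `d d* = φ n (φ n)*`, and the row norm depends on nothing else. On the column side `d* d = f (φ
n)* (φ n) f`, a conjugation that seems to depend on `n`. But `f` anticommutes with every `field J
v`, `v ∈ K (n - 1)`, and so does the parity operator; their product therefore commutes with the
whole algebra of `K (n - 1)`, where `f` and the parity operator induce the same conjugation
(`field_mul_mul_field`). Hence a single automorphism, `parityAut`, carries `(φ n)* (φ n)` to `d* d`
for all `n` at once. It fixes the vacuum state, so it preserves the `L^p` norms of the square
functions (`columnNorm_eq_of_map`). The column norms are thus equal, and the constants `1/2` and `2`
are only slack. The remaining work is to obtain the anticommutation relations on the Fock space. -/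

theorem map_sqrt_of_nonneg (α : (F →L[ℂ] F) ≃⋆ₐ[ℂ] (F →L[ℂ] F)) {x : F →L[ℂ] F} (hx : 0 ≤ x) :
    α (CFC.sqrt x) = CFC.sqrt (α x) := by
  refine (CFC.sqrt_unique ?_ (map_nonneg α (CFC.sqrt_nonneg x))).symm
  rw [← map_mul, CFC.sqrt_mul_sqrt_self x hx]

theorem map_abs (α : (F →L[ℂ] F) ≃⋆ₐ[ℂ] (F →L[ℂ] F)) (x : F →L[ℂ] F) :
    α (CFC.abs x) = CFC.abs (α x) := by
  rw [CFC.abs, CFC.abs, map_sqrt_of_nonneg α (star_mul_self_nonneg x), map_mul, map_star]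

/-- A trace-preserving `*`-automorphism preserves the `L^p` norms. -/
theorem lpNorm_map (α : (F →L[ℂ] F) ≃⋆ₐ[ℂ] (F →L[ℂ] F)) {τ : (F →L[ℂ] F) → ℂ}
    (hτ : ∀ x, τ (α x) = τ x) (p : ℝ≥0∞) (x : F →L[ℂ] F) :
    lpNorm τ p (α x) = lpNorm τ p x := by
  -- An injective `*`-homomorphism of C*-algebras is isometric: this settles `p = ∞` and gives the
  -- continuity needed to pass `α` through the functional calculus.
  have hα : Isometry α := NonUnitalStarAlgHom.isometry α α.injective
  unfold lpNorm
  split_ifs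
  · rw [(AddMonoidHomClass.isometry_iff_norm α).1 hα]
  · rw [← map_abs, CFC.rpow_def, ← StarAlgHomClass.map_cfc α (fun t : NNReal => t ^ p.toReal)
      (CFC.abs x) (NNReal.continuous_rpow_const ENNReal.toReal_nonneg).continuousOn hα.continuous
      (CFC.abs_nonneg x) (map_nonneg α (CFC.abs_nonneg x)), hτ, CFC.rpow_def]

/-- It is essential that `α` does not depend on `k`: only then can it be pulled out of the sum and
then out of the square root. -/
theorem columnNorm_eq_of_map (α : (F →L[ℂ] F) ≃⋆ₐ[ℂ] (F →L[ℂ] F)) {τ : (F →L[ℂ] F) → ℂ}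
    (hτ : ∀ x, τ (α x) = τ x) (p : ℝ≥0∞) {a b : ℕ → F →L[ℂ] F}
    (h : ∀ k, star (a k) * a k = α (star (b k) * b k)) :
    columnNorm τ p a = columnNorm τ p b := by
  refine iSup_congr fun n => ?_
  simp only [CFC.abs_sq, h]
  rw [← map_sum, ← map_sqrt_of_nonneg α (Finset.sum_nonneg fun k _ => star_mul_self_nonneg (b k)),
    lpNorm_map α hτ]

theorem rowNorm_congr (τ : (F →L[ℂ] F) → ℂ) (p : ℝ≥0∞) {a b : ℕ → F →L[ℂ] F}
    (h : ∀ k, a k * star (a k) = b k * star (b k)) :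
    rowNorm τ p a = rowNorm τ p b := by
  simp only [rowNorm, CFC.abs_sq, star_star, h]

/-- An element of the von Neumann algebra generated by a self-adjoint set commutes with the
commutant of that set. -/
theorem commute_of_mem_vonNeumannGenerated {S : Set (F →L[ℂ] F)} (hS : ∀ s ∈ S, star s ∈ S)
    {y z : F →L[ℂ] F} (hy : y ∈ vonNeumannGenerated S) (hz : ∀ s ∈ S, Commute s z) :
    Commute z y := by
  have hy' : y ∈ StarSubalgebra.centralizer ℂ
      (StarSubalgebra.centralizer ℂ S : Set (F →L[ℂ] F)) := hy
  refine (StarSubalgebra.mem_centralizer_iff ℂ |>.1 hy' z ?_).1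
  -- Membership in the commutant as a `*`-subalgebra asks for commutation with both `s` and `star
  -- s`; the latter is where `hS` enters.
  exact (StarSubalgebra.mem_centralizer_iff ℂ).2 fun s hs => ⟨hz s hs, hz _ (hS s hs)⟩

end StarAut

/-! ### Anticommutation and parity on formal wedge products. -/

section PreFock

variable {H : Type*} [NormedAddCommGroup H] [InnerProductSpace ℂ H]

/-- Removing the leading factor `v` gives the scalar term; removing any later factor shifts its
index by one, which flips the sign. Two different vectors are needed to compare the field at `e n`
with those of the smaller space. -/
theorem preAnnihilator_preCreator_anticomm (w v : H) (f : PreFock H) :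
    preAnnihilator w (preCreator v f) =
      inner ℂ w v • f - preCreator v (preAnnihilator w f) := by
  induction f using preFock_induction with
  | h0 => simp
  | hadd f g hf hg => simp only [map_add, hf, hg, smul_add]; abel
  | hw c n u =>
    simp only [map_smul]
    rw [smul_comm, ← smul_sub]
    congr 1
    rw [preCreator_preWedge, preAnnihilator_preWedge_succ, Fin.sum_univ_succ]
    have h0 : (Fin.cons v u : Fin (n + 1) → H) ∘ (0 : Fin (n + 1)).succAbove = u := by
      ext i; simp
    rw [h0, sub_eq_add_neg]
    congr 1
    · simp
    · cases n with
      | zero => rw [preAnnihilator_preWedge_zero]; simp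
      | succ n =>
        rw [preAnnihilator_preWedge_succ, map_sum, ← Finset.sum_neg_distrib]
        refine Finset.sum_congr rfl fun j _ => ?_
        have hj : (Fin.cons v u : Fin (n + 2) → H) ∘ j.succ.succAbove =
            Fin.cons v (u ∘ j.succAbove) := by
          ext i
          refine Fin.cases ?_ (fun i => ?_) i <;> simp
        rw [hj, map_smul, preCreator_preWedge, ← neg_smul]
        congr 1
        simp [pow_succ]

/-- The parity operator on formal combinations: `u_1 ∧ ⋯ ∧ u_n ↦ (-1)^n u_1 ∧ ⋯ ∧ u_n`. -/
noncomputable def preParity : PreFock H →ₗ[ℂ] PreFock H :=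
  preLift fun x => (-1 : ℂ) ^ x.1 • preWedge x.1 x.2

theorem preParity_preWedge (n : ℕ) (u : Fin n → H) :
    preParity (preWedge n u) = (-1 : ℂ) ^ n • preWedge n u :=
  preLift_preWedge _ _ _

theorem preParity_preParity (f : PreFock H) : preParity (preParity f) = f := by
  induction f using preFock_induction with
  | h0 => simp
  | hadd f g hf hg => rw [map_add, map_add, hf, hg]
  | hw c n u =>
    rw [map_smul, map_smul, preParity_preWedge, map_smul, preParity_preWedge,
      smul_smul ((-1 : ℂ) ^ n), ← mul_pow]
    simp

theorem preParity_preCreator (v : H) (f : PreFock H) :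
    preParity (preCreator v f) = -preCreator v (preParity f) := by
  induction f using preFock_induction with
  | h0 => simp
  | hadd f g hf hg => simp only [map_add, hf, hg, neg_add]
  | hw c n u =>
    simp only [map_smul, preCreator_preWedge, preParity_preWedge, pow_succ]
    simp

theorem inner_preParity_left (f g : PreFock H) :
    inner ℂ (preParity f) g = inner ℂ f (preParity g) := by
  induction f using preFock_induction with
  | h0 => simp
  | hadd f f' hf hf' => rw [map_add, inner_add_left, inner_add_left, hf, hf']
  | hw c n u =>
    rw [map_smul, inner_smul_left, inner_smul_left]
    congr 1
    induction g using preFock_induction with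
    | h0 => simp
    | hadd g g' hg hg' => rw [map_add, inner_add_right, inner_add_right, hg, hg']
    | hw d m w =>
      rw [map_smul, inner_smul_right, inner_smul_right]
      congr 1
      rw [preParity_preWedge, preParity_preWedge, inner_smul_left, inner_smul_right,
        inner_preWedge]
      by_cases h : n = m
      · subst h; simp
      · simp [wedgeKernel_ne h]

/-- A symmetric involution preserves norms, so parity extends to the completion. -/
theorem norm_preParity (f : PreFock H) : ‖preParity f‖ = ‖f‖ := by
  rw [@norm_eq_sqrt_re_inner ℂ, @norm_eq_sqrt_re_inner ℂ, inner_preParity_left,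
    preParity_preParity]

end PreFock

/-! ### Creators, annihilators and parity as bounded operators. -/

section Fock

variable {H : Type*} [NormedAddCommGroup H] [InnerProductSpace ℂ H]

/-- The canonical isometry from formal combinations of wedge products to the Fock space. -/
noncomputable def ofPre : PreFock H →ₗᵢ[ℂ] Fock H :=
  UniformSpace.Completion.toComplₗᵢ

theorem denseRange_ofPre : DenseRange (ofPre : PreFock H → Fock H) :=
  UniformSpace.Completion.denseRange_coe

theorem ofPre_preWedge (n : ℕ) (u : Fin n → H) : ofPre (preWedge n u) = wedge n u := rfl

theorem ext_ofPre {A B : Fock H →L[ℂ] Fock H} (h : ∀ f, A (ofPre f) = B (ofPre f)) : A = B :=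
  ContinuousLinearMap.ext fun x => congrFun
    (denseRange_ofPre.equalizer A.continuous B.continuous (funext h)) x

theorem ext_wedge {A B : Fock H →L[ℂ] Fock H} (h : ∀ n u, A (wedge n u) = B (wedge n u)) :
    A = B := by
  refine ext_ofPre fun f => ?_
  induction f using preFock_induction with
  | h0 => simp
  | hadd f g hf hg => simp only [map_add, hf, hg]
  | hw c n u => simp only [map_smul, ofPre_preWedge, h]

theorem creator_ofPre (v : H) (f : PreFock H) : creator v (ofPre f) = ofPre (preCreator v f) :=
  ContinuousLinearMap.completion_apply_coe _ _

/-- The annihilator is defined as an adjoint; testing against the dense formal combinations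
identifies it with the explicit alternating formula. -/
theorem annihilator_ofPre (v : H) (f : PreFock H) :
    annihilator v (ofPre f) = ofPre (preAnnihilator v f) := by
  refine (denseRange_ofPre (H := H)).eq_of_inner_right ℂ ?_
  intro g
  rw [annihilator, ContinuousLinearMap.adjoint_inner_right, creator_ofPre,
    LinearIsometry.inner_map_map, LinearIsometry.inner_map_map, inner_preCreator]

/-- The parity operator `u_1 ∧ ⋯ ∧ u_n ↦ (-1)^n u_1 ∧ ⋯ ∧ u_n` on the Fock space. -/
noncomputable def parity (H : Type*) [NormedAddCommGroup H] [InnerProductSpace ℂ H] :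
    Fock H →L[ℂ] Fock H :=
  ((preParity (H := H)).mkContinuous 1
    fun f => by rw [one_mul, norm_preParity]).completion

theorem parity_ofPre (f : PreFock H) : parity H (ofPre f) = ofPre (preParity f) :=
  ContinuousLinearMap.completion_apply_coe _ _

theorem parity_mul_parity : parity H * parity H = 1 :=
  ext_ofPre fun f => by
    rw [mul_apply_eq_comp, parity_ofPre, parity_ofPre, preParity_preParity]
    rfl

theorem star_parity : star (parity H) = parity H := by
  refine ext_ofPre fun f => (denseRange_ofPre (H := H)).eq_of_inner_right ℂ ?_
  intro g
  rw [ContinuousLinearMap.star_eq_adjoint, ContinuousLinearMap.adjoint_inner_right, parity_ofPre,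
    parity_ofPre, LinearIsometry.inner_map_map, LinearIsometry.inner_map_map,
    inner_preParity_left]

theorem parity_vacuum : parity H (vacuum H) = vacuum H := by
  rw [vacuum, ← ofPre_preWedge, parity_ofPre, preParity_preWedge, pow_zero, one_smul]

theorem parity_mul_creator (v : H) : parity H * creator v = -(creator v * parity H) :=
  ext_ofPre fun f => by
    simp only [mul_apply_eq_comp, neg_apply, parity_ofPre,
      creator_ofPre, preParity_preCreator, map_neg]

theorem star_creator (v : H) : star (creator v) = annihilator v := rfl

theorem star_annihilator (v : H) : star (annihilator v) = creator v := by
  rw [← star_creator, star_star]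

theorem parity_mul_annihilator (v : H) :
    parity H * annihilator v = -(annihilator v * parity H) := by
  have h := congrArg star (parity_mul_creator v)
  simp only [star_mul, star_neg, star_creator, star_parity] at h
  rw [h, neg_neg]

theorem annihilator_mul_creator (w v : H) :
    annihilator w * creator v + creator v * annihilator w = inner ℂ w v • 1 :=
  ext_ofPre fun f => by
    simp only [mul_apply_eq_comp, add_apply, creator_ofPre,
      annihilator_ofPre, preAnnihilator_preCreator_anticomm, map_sub, map_smul, sub_add_cancel]
    rfl

/-- Formal wedges are not antisymmetric; the identity appears only after null vectors are
identified. Swapping two rows negates every Gram determinant, so the sum of both sides has norm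
zero. -/
theorem wedge_cons_cons_swap (v w : H) (n : ℕ) (u : Fin n → H) :
    wedge (n + 2) (Fin.cons v (Fin.cons w u : Fin (n + 1) → H)) =
      -wedge (n + 2) (Fin.cons w (Fin.cons v u : Fin (n + 1) → H)) := by
  set a : Fin (n + 2) → H := Fin.cons v (Fin.cons w u : Fin (n + 1) → H)
  set b : Fin (n + 2) → H := Fin.cons w (Fin.cons v u : Fin (n + 1) → H)
  have hab : a = b ∘ Equiv.swap 0 1 := by
    ext i
    refine Fin.cases ?_ (fun i => Fin.cases ?_ (fun i => ?_) i) i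
    · simp [a, b]
    · simp [a, b]
    · have h : Equiv.swap (0 : Fin (n + 2)) 1 i.succ.succ = i.succ.succ :=
        Equiv.swap_apply_of_ne_of_ne (Fin.succ_ne_zero _)
          (by rw [← Fin.succ_zero_eq_one]; exact fun h => Fin.succ_ne_zero _ (Fin.succ_injective _ h))
      simp [a, b, h]
  have hs : ∀ z : Fin (n + 2) → H, inner ℂ (wedge (n + 2) a) (wedge (n + 2) z) =
      -inner ℂ (wedge (n + 2) b) (wedge (n + 2) z) := by
    intro z
    rw [inner_wedge_wedge, inner_wedge_wedge, hab]
    have h := Matrix.det_permute (Equiv.swap (0 : Fin (n + 2)) 1)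
      (Matrix.of fun i j => inner ℂ (b i) (z j))
    rw [Equiv.Perm.sign_swap (by simp)] at h
    simpa [Matrix.submatrix] using h
  rw [eq_neg_iff_add_eq_zero, ← inner_self_eq_zero (𝕜 := ℂ), inner_add_left, inner_add_right,
    inner_add_right, hs, hs]
  ring

theorem creator_mul_creator (v w : H) :
    creator v * creator w = -(creator w * creator v) :=
  ext_wedge fun n u => by
    simp only [mul_apply_eq_comp, neg_apply, creator_wedge]
    exact wedge_cons_cons_swap v w n u

theorem annihilator_mul_annihilator (v w : H) :
    annihilator v * annihilator w = -(annihilator w * annihilator v) := by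
  have h := congrArg star (creator_mul_creator w v)
  simpa only [star_mul, star_neg, star_creator] using h

/-- A formal wedge with a zero factor is a nonzero combination of norm zero, so the norm bound is
used. -/
theorem creator_zero : creator (0 : H) = 0 :=
  ext_ofPre fun f => by
    have h : ‖preCreator (0 : H) f‖ ≤ 0 := (norm_preCreator_le 0 f).trans (by simp)
    rw [creator_ofPre, zero_apply, ← norm_eq_zero, LinearIsometry.norm_map]
    exact le_antisymm h (norm_nonneg _)

theorem annihilator_zero : annihilator (0 : H) = 0 := by
  rw [← star_creator, creator_zero, star_zero]

/-- Conjugation by the parity operator. -/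
noncomputable def parityAut (H : Type*) [NormedAddCommGroup H] [InnerProductSpace ℂ H] :
    (Fock H →L[ℂ] Fock H) ≃⋆ₐ[ℂ] (Fock H →L[ℂ] Fock H) :=
  Unitary.conjStarAlgAut ℂ _ ⟨parity H, by
    rw [Unitary.mem_iff, star_parity, parity_mul_parity]; exact ⟨rfl, rfl⟩⟩

theorem parityAut_apply (x : Fock H →L[ℂ] Fock H) :
    parityAut H x = parity H * x * parity H := by
  rw [parityAut, Unitary.conjStarAlgAut_apply, star_parity]

theorem vacuumTrace_parityAut (x : Fock H →L[ℂ] Fock H) :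
    vacuumTrace (parityAut H x) = vacuumTrace x := by
  rw [vacuumTrace, vacuumTrace, parityAut_apply, mul_apply_eq_comp,
    mul_apply_eq_comp, parity_vacuum, ← ContinuousLinearMap.adjoint_inner_left,
    ← ContinuousLinearMap.star_eq_adjoint, star_parity, parity_vacuum]

end Fock

/-! ### Anticommutation of the fields and conjugation by a field. -/

section Field

variable {H : Type*} [NormedAddCommGroup H] [InnerProductSpace ℂ H] (J : H ≃ₗᵢ⋆[ℂ] H)

theorem star_field (hJ : ∀ v, J (J v) = v) (v : H) : star (field J v) = field J (J v) := by
  rw [field, field, star_add, star_creator, star_annihilator, hJ, add_comm]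

theorem field_zero : field J 0 = 0 := by
  rw [field, map_zero, creator_zero, annihilator_zero, add_zero]

theorem parity_mul_field (v : H) : parity H * field J v = -(field J v * parity H) := by
  rw [field, mul_add, add_mul, parity_mul_creator, parity_mul_annihilator, neg_add]

/-- The canonical anticommutation relations. -/
theorem field_mul_field (v w : H) :
    field J v * field J w + field J w * field J v =
      (inner ℂ (J v) w + inner ℂ (J w) v : ℂ) • 1 := by
  have h1 := annihilator_mul_creator (J v) w
  have h2 := annihilator_mul_creator (J w) v
  rw [add_smul, ← h1, ← h2]
  simp only [field, mul_add, add_mul]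
  -- The terms with two creators or two annihilators cancel; the mixed terms are those in `h1` and
  -- `h2`.
  rw [creator_mul_creator v w, annihilator_mul_annihilator (J v) (J w)]
  abel

theorem field_mul_self {e : H} (he : J e = e) (hnorm : ‖e‖ = 1) :
    field J e * field J e = 1 := by
  have h := field_mul_field J e e
  rw [he, inner_self_eq_norm_sq_to_K, hnorm, ← two_smul ℂ] at h
  refine smul_right_injective _ (two_ne_zero' ℂ) (h.trans ?_)
  norm_num

theorem star_mem_field_image (hJ : ∀ v, J (J v) = v) {K : Submodule ℂ H}
    (hKJ : ∀ v ∈ K, J v ∈ K) : ∀ s ∈ field J '' (K : Set H), star s ∈ field J '' (K : Set H) := by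
  rintro _ ⟨v, hv, rfl⟩
  exact ⟨J v, hKJ v hv, (star_field J hJ v).symm⟩

/-- On `C(K)`, conjugation by `Φ(e)` with `e ⊥ K` is conjugation by the parity operator. -/
theorem field_mul_mul_field (hJ : ∀ v, J (J v) = v) {K : Submodule ℂ H}
    (hKJ : ∀ v ∈ K, J v ∈ K) {e : H} (he : J e = e) (hnorm : ‖e‖ = 1) (horth : e ∈ Kᗮ)
    {y : Fock H →L[ℂ] Fock H} (hy : y ∈ cliffordAlg J K) :
    field J e * y * field J e = parityAut H y := by
  -- Moving a generator past `field J e` and then past the parity operator costs two signs, which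
  -- cancel.
  have hc : Commute (parity H * field J e) y := by
    refine commute_of_mem_vonNeumannGenerated (star_mem_field_image J hJ hKJ) hy ?_
    rintro _ ⟨v, hv, rfl⟩
    have h := field_mul_field J e v
    -- Both scalar products vanish, the second because `J v` also lies in `K`.
    rw [he, Submodule.inner_left_of_mem_orthogonal hv horth,
      Submodule.inner_right_of_mem_orthogonal (hKJ v hv) horth, add_zero, zero_smul] at h
    rw [commute_iff_eq, mul_assoc, eq_neg_of_add_eq_zero_left h, mul_neg, ← mul_assoc,
      ← mul_assoc, parity_mul_field, neg_mul, neg_neg]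
  have hΓ := parity_mul_parity (H := H)
  have hf := field_mul_self J he hnorm
  calc field J e * y * field J e
      = parity H * parity H * field J e * y * field J e := by rw [hΓ, one_mul]
    _ = parity H * (parity H * field J e * y) * field J e := by simp only [mul_assoc]
    _ = parity H * (y * (parity H * field J e)) * field J e := by rw [hc.eq]
    _ = parity H * y * parity H * (field J e * field J e) := by simp only [mul_assoc]
    _ = parityAut H y := by rw [hf, mul_one, parityAut_apply]

/-- The only generator is `field J 0 = 0`, so every operator is in the commutant. This serves the
index `0`, where no field is available to implement the parity. -/
theorem parityAut_of_mem_bot (hJ : ∀ v, J (J v) = v) {y : Fock H →L[ℂ] Fock H}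
    (hy : y ∈ cliffordAlg J (⊥ : Submodule ℂ H)) : parityAut H y = y := by
  have hc : Commute (parity H) y := by
    refine commute_of_mem_vonNeumannGenerated (star_mem_field_image J hJ ?_) hy ?_
    · rintro v hv
      rw [Submodule.mem_bot] at hv ⊢
      rw [hv, map_zero]
    · rintro _ ⟨v, hv, rfl⟩
      rw [SetLike.mem_coe, Submodule.mem_bot] at hv
      rw [hv, field_zero]
      exact Commute.zero_left _
  rw [parityAut_apply, hc.eq, mul_assoc, parity_mul_parity, mul_one]

end Field

end Clifford

/-! ### The row and column norms of a Clifford martingale. -/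

theorem proposition3p3 {H : Type*} [NormedAddCommGroup H] [InnerProductSpace ℂ H]
    [CompleteSpace H]
    -- a conjugation on `H`
    (J : H ≃ₗᵢ⋆[ℂ] H) (hJ : ∀ v, J (J v) = v)
    -- an increasing sequence of `J`-invariant subspaces with `dim (K n) = n` and dense union
    (K : ℕ → Submodule ℂ H) [∀ n, FiniteDimensional ℂ (K n)] (hK : Monotone K)
    (hKJ : ∀ n, ∀ v ∈ K n, J v ∈ K n) (hdim : ∀ n, Module.finrank ℂ (K n) = n)
    (hdense : (⨆ n, K n).topologicalClosure = ⊤)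
    -- a `J`-real orthonormal basis `(e n)`, `n ≥ 1`, with `e n ∈ K n ⊖ K (n - 1)`
    (e : ℕ → H) (heJ : ∀ n, J (e (n + 1)) = e (n + 1)) (henorm : ∀ n, ‖e (n + 1)‖ = 1)
    (hemem : ∀ n, e (n + 1) ∈ K (n + 1)) (heorth : ∀ n, e (n + 1) ∈ (K n)ᗮ)
    (p : ℝ≥0∞) (hp : 1 ≤ p)
    (x : ℕ → Clifford.Fock H →L[ℂ] Clifford.Fock H) (hx : 
      Clifford.IsMartingale Clifford.vacuumTrace (fun n => Clifford.cliffordAlg J (K n)) x)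
    -- `dx n = φ n * Φ (e n)` with `φ n` in the algebra of index `n - 1`; for `n = 0` the
    -- conventions are that `Φ (e 0)` is the unit and that the algebra of index `-1` is the one
    -- of index `0`, namely the scalars
    (φ : ℕ → Clifford.Fock H →L[ℂ] Clifford.Fock H)
    (hφ0 : φ 0 ∈ Clifford.cliffordAlg J (K 0))
    (hφ : ∀ n, φ (n + 1) ∈ Clifford.cliffordAlg J (K n))
    (hdx0 : Clifford.martingaleDiff x 0 = φ 0)
    (hdx : ∀ n, Clifford.martingaleDiff x (n + 1) = φ (n + 1) * Clifford.field J (e (n + 1))) :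
    Clifford.rowNorm Clifford.vacuumTrace p (Clifford.martingaleDiff x) =
        Clifford.rowNorm Clifford.vacuumTrace p φ ∧
      2⁻¹ * Clifford.columnNorm Clifford.vacuumTrace p φ ≤
        Clifford.columnNorm Clifford.vacuumTrace p (Clifford.martingaleDiff x) ∧
      Clifford.columnNorm Clifford.vacuumTrace p (Clifford.martingaleDiff x) ≤
        2 * Clifford.columnNorm Clifford.vacuumTrace p φ := by 
  have hsq : ∀ n, Clifford.field J (e (n + 1)) * Clifford.field J (e (n + 1)) = 1 := fun n =>
    Clifford.field_mul_self J (heJ n) (henorm n)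
  have hstar : ∀ n, star (Clifford.field J (e (n + 1))) = Clifford.field J (e (n + 1)) := fun n => by
    rw [Clifford.star_field J hJ, heJ]
  have hrow : ∀ k, Clifford.martingaleDiff x k * star (Clifford.martingaleDiff x k) =
      φ k * star (φ k) := by
    rintro (_ | n)
    · rw [hdx0]
    · rw [hdx, star_mul, hstar, mul_assoc, ← mul_assoc (Clifford.field J _), hsq, one_mul]
  have hcol : ∀ k, star (Clifford.martingaleDiff x k) * Clifford.martingaleDiff x k =
      Clifford.parityAut H (star (φ k) * φ k) := by
    rintro (_ | n)
    · rw [Submodule.finrank_eq_zero.1 (hdim 0)] at hφ0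
      rw [hdx0, Clifford.parityAut_of_mem_bot J hJ (mul_mem (star_mem hφ0) hφ0)]
    · rw [hdx, star_mul, hstar, ← Clifford.field_mul_mul_field J hJ (hKJ n) (heJ n) (henorm n)
        (heorth n) (mul_mem (star_mem (hφ n)) (hφ n))]
      simp only [mul_assoc]
  -- This is an equality of column norms; both bounds follow by weakening it.
  have hC := Clifford.columnNorm_eq_of_map (Clifford.parityAut H)
    Clifford.vacuumTrace_parityAut p hcol
  refine ⟨Clifford.rowNorm_congr _ p hrow, ?_, ?_⟩
  · rw [hC]
    exact mul_le_of_le_one_left' (ENNReal.inv_le_one.2 one_le_two)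
  · rw [hC]
    exact le_mul_of_one_le_left' one_le_two
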